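/- **Model.** Time is divided into slots $1,2,3,\dots$ on a multiple-access channel without collision detection. Each node joins the system at the beginning of some slot with one message, and in each slot it is in the system it either broadcasts or stays idle. A slot is successful if it is not jammed and exactly one node broadcasts in it; that node then leaves the system immediately. The only feedback, which is identical for all nodes in the system and for the adversary, is whether the slot was successful. All nodes run the same randomized algorithm $\mathcal A$, independently of each other, starting on arrival; the broadcasting probability of a node in a slot depends only on its own record since its arrival (in which slots it broadcast, and which slots were successful). An adaptive adversary decides at the beginning of each slot, from the feedback of the past slots, whether to jam the slot and how many new nodes to inject. A slot is *active* if at least one node is in the system in it. Let $n_t$ and $d_t$ be the numbers of nodes injected and of slots jammed in the first $t$ slots. Let $f,g$ be functions that are positive on the positive reals. $\mathcal A$ *achieves $(f,g)$-throughput* if for every integer $t\ge 1$ and every adaptive adversary the number of active slots among the first $t$ slots is at most $n_t f(t)+d_t g(t)$ with high probability in $n_t$, i.e. there is a constant $c\ge 1$ such that for all integers $t\ge1$, all adaptive adversaries and all integers $n\ge 1$, the event that $n_t=n$ and that this bound fails has probability at most $1/n^c$. A function $h$ on the positive reals is *sub-logarithmic* if (1) $h(x)\in O(\log x)$ and $h$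 is non-decreasing; (2) there are constants $y_0>0$ and $x_0$ such that $h(x)\ge y_0$ for all $x\ge x_0$; (3) for every constant $c>0$ there is a constant $c_0$ such that $|h(cn)-h(n)|\le c_0$ for all positive integers $n$; (4) $h(x^c)\in\Theta(h(x))$ for every constant $c>0$. **Theorem.** Let $\mathcal A$ be an algorithm for which there is a fixed sequence of probabilities $a_1,a_2,\dots$ such that a node that has not yet heard any success broadcasts in the $i$-th slot since its arrival with probability $a_i$, whatever it did in its previous slots (after the first success that the node hears, $\mathcal A$ is arbitrary). Let $f,g$ be functions, positive on the positive reals, such that $f$ and $\log g$ are sub-logarithmic and $f(x)=o\left(\frac{\log x}{\log g(x)}\right)$. Then $\mathcal A$ does not achieve $(f,g)$-throughput. -/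

import Mathlib

open Filter Asymptotics MeasureTheory Set

noncomputable section

/-! ### Sub-logarithmic functions -/

/-- Sub-logarithmic functions on the positive reals: `O(log x)` and non-decreasing, eventually
bounded below by a positive constant, with bounded change under scaling of the argument, and
changing only by a constant factor under powers of the argument. -/
structure SubLogarithmic (h : ℝ → ℝ) : Prop where
  isBigO_log : h =O[atTop] Real.log
  monotoneOn : MonotoneOn h (Ioi 0)
  eventually_ge : ∃ y₀ > 0, ∃ x₀ : ℝ, ∀ x ≥ x₀, y₀ ≤ h x
  scaling : ∀ c > 0, ∃ c₀ : ℝ, ∀ n : ℕ, 0 < n → |h (c * n) - h n| ≤ c₀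
  power : ∀ c : ℝ, 0 < c → (fun x : ℝ => h (x ^ c)) =Θ[atTop] h

/-! ### Algorithms and adversaries

Slots are numbered `1, 2, 3, …`.  There is no collision detection: the channel feedback of a slot
is a Boolean, `true` if a message was successfully transmitted in the slot, and `false` otherwise
(silence, collision and jamming are indistinguishable). -/

/-- What a node remembers of one slot it has been through. -/
structure LocalRecord where
  /-- whether the node itself broadcast in the slot -/
  sent : Bool
  /-- whether the node heard a successful transmission in the slot -/
  heardSuccess : Bool

/-- A (randomized) contention resolution algorithm, run by every node from its arrival on.  It
gives the probability with which a node broadcasts in its next slot, conditionally on the records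
of all slots since its arrival (most recent slot first; empty in the node's first slot).  There is
no global clock and there are no node identities. -/
structure Algorithm where
  sendProb : List LocalRecord → unitInterval

/-- Before it hears any success, a node running `A` broadcasts in the `i`-th slot since its arrival
(`i = 1, 2, …`) with the pre-defined probability `a i`, whatever it did in its previous slots. -/
def Algorithm.NonAdaptiveBeforeSuccess (A : Algorithm) (a : ℕ → unitInterval) : Prop :=
  ∀ past : List LocalRecord, (∀ r ∈ past, r.heardSuccess = false) →
    A.sendProb past = a (past.length + 1)

/-- An adaptive adversary.  At the beginning of each slot it decides, from the channel feedback of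
all past slots (most recent slot first), whether to jam the slot and how many new nodes to inject. -/
structure Adversary where
  jam : List Bool → Bool
  inject : List Bool → ℕ

/-! ### The execution -/

/-- The name of a node (not visible to the algorithm): the slot of its arrival and a number that
distinguishes the nodes arriving in that slot. -/
abbrev NodeId := ℕ × ℕ

/-- Outcomes of the coins: `ω (u, s)` is the coin of node `u` in slot `s`. -/
abbrev Coins := NodeId × ℕ → unitInterval

/-- All coins are independent and uniformly distributed on `[0, 1]`. -/
def coinMeasure : Measure Coins := Measure.infinitePi fun _ : NodeId × ℕ => (volume : Measure unitInterval)

/-- The state of the system after some number of slots. -/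
structure ChannelState where
  /-- channel feedback of the past slots, most recent first -/
  feedback : List Bool
  /-- the nodes that have arrived and have not yet succeeded -/
  alive : Finset NodeId
  /-- the records of each node since its arrival, most recent first -/
  records : NodeId → List LocalRecord
  /-- number of nodes that have arrived -/
  arrivals : ℕ
  /-- number of jammed slots -/
  jammed : ℕ
  /-- number of active slots, those with at least one node in the system -/
  active : ℕ

/-- The state before the first slot. -/
def ChannelState.initial : ChannelState where
  feedback := []
  alive := ∅
  records := fun _ => []
  arrivals := 0
  jammed := 0
  active := 0

/-- The nodes in the system in slot `s`: those left over from before, and those injected at the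
beginning of slot `s`. -/
def ChannelState.present (adv : Adversary) (s : ℕ) (st : ChannelState) : Finset NodeId :=
  st.alive ∪ (Finset.range (adv.inject st.feedback)).image fun j => (s, j)

/-- The nodes that broadcast in slot `s`. -/
def ChannelState.senders (A : Algorithm) (adv : Adversary) (ω : Coins) (s : ℕ) (st : ChannelState) :
    Finset NodeId :=
  (st.present adv s).filter fun u => ω (u, s) < A.sendProb (st.records u)

/-- Slot `s` is successful: it is not jammed and exactly one node broadcasts. -/
def ChannelState.success (A : Algorithm) (adv : Adversary) (ω : Coins) (s : ℕ) (st : ChannelState) :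
    Bool :=
  !adv.jam st.feedback && decide ((st.senders A adv ω s).card = 1)

/-- The state after slot `s`, from the state `st` before it.  A node whose broadcast succeeds leaves
the system immediately. -/
def ChannelState.step (A : Algorithm) (adv : Adversary) (ω : Coins) (s : ℕ) (st : ChannelState) :
    ChannelState where
  feedback := st.success A adv ω s :: st.feedback
  alive :=
    if st.success A adv ω s then st.present adv s \ st.senders A adv ω s else st.present adv s
  records := fun u =>
    if u ∈ st.present adv s then
      ⟨decide (u ∈ st.senders A adv ω s), st.success A adv ω s⟩ :: st.records u
    else st.records u
  arrivals := st.arrivals + adv.inject st.feedback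
  jammed := st.jammed + if adv.jam st.feedback then 1 else 0
  active := st.active + if (st.present adv s).Nonempty then 1 else 0

/-- The state after the first `t` slots. -/
def execution (A : Algorithm) (adv : Adversary) (ω : Coins) : ℕ → ChannelState
  | 0 => ChannelState.initial
  | t + 1 => (execution A adv ω t).step A adv ω (t + 1)

/-! ### Throughput -/

/-- `(f, g)`-throughput: for every `t ≥ 1` and every adaptive adversary, the number of active slots
among the first `t` slots is at most `n_t * f t + d_t * g t` with high probability in `n_t`, where
`n_t` and `d_t` are the numbers of arrived nodes and of jammed slots in the first `t` slots.

As `n_t` may depend on the execution, the error bound `1 / n ^ c` is imposed for every `n ≥ 1` on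
the event that `n_t = n` and the bound fails; if the adversary injects a fixed number `n` of nodes
then this is the probability that the bound fails.  Since these inequalities are preserved by
averaging over adversaries, randomized adversaries would give the same notion. -/
def Algorithm.AchievesThroughput (A : Algorithm) (f g : ℝ → ℝ) : Prop :=
  ∃ c : ℝ, 1 ≤ c ∧ ∀ t : ℕ, 1 ≤ t → ∀ adv : Adversary, ∀ n : ℕ, 1 ≤ n →
    coinMeasure {ω | (execution A adv ω t).arrivals = n ∧
      (n : ℝ) * f t + ((execution A adv ω t).jammed : ℝ) * g t
        < ((execution A adv ω t).active : ℝ)}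
      ≤ ENNReal.ofReal (1 / (n : ℝ) ^ c)

end

/-! As long as no slot succeeds, nobody leaves and a node of age `i` broadcasts with probability `a
i`, so against an oblivious adversary the event of no success depends on independent coins only. If
the adversary makes the throughput bound fail whenever the channel stays quiet, quietness must have
probability at most `1 / n` (`measure_quietEvent_le`). Two such adversaries put contradictory
demands on the `a i`.

The `a i` must be large. Two nodes start in slot 1, the first `r` of `r * q` slots are jammed, with
`q ≥ 4 * g`, and about `s / (2 * f s)` nodes join in the last slot `s = r * q`. The two nodes are
quiet if both always do their more likely action, which has probability at least `exp (-4 * ∑ a i)`,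
the sum being over the unjammed slots before the last. Hence each window of ages `(r, r * q]`
carries a sum of at least `log s / 8` (`log_le_sum_Ioc`). About `log z / log q` windows fit between
`z` and `z ^ 2`, and `f = o(log / log g)` makes this number far exceed `f`: the sum up to age `z ^
2` is at least `10 * L * log z`, with `L` about `4 * f (z ^ 4)`.

The `a i` must not be that large. Over about `z ^ 4` slots, one node arrives at a random place of
each block of `L` slots, and the first `z ^ 2` slots are jammed. In every later slot the expected
number of broadcasts is at least `10 * log z`, so collisions make success unlikely in all slots at
once (`exists_blockSlot_quiet`), although nodes and jams are too few to pay for that many active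
slots. -/

noncomputable section

/-! ### Oblivious adversaries and executions without a success -/

/-- The adversary that injects `inj s` nodes in slot `s` and jams it if `jm s`, whatever the
feedback. -/
def obliviousAdversary (inj : ℕ → ℕ) (jm : ℕ → Bool) : Adversary where
  jam h := jm (h.length + 1)
  inject h := inj (h.length + 1)

/-- The nodes injected in the first `s` slots. -/
def injectedNodes (inj : ℕ → ℕ) (s : ℕ) : Finset NodeId :=
  (Finset.Icc 1 s).biUnion fun u => (Finset.range (inj u)).image fun j => (u, j)

/-- The nodes that broadcast in slot `s` if no success has been heard before. -/
def quietSenders (a : ℕ → unitInterval) (inj : ℕ → ℕ) (ω : Coins) (s : ℕ) : Finset NodeId :=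
  (injectedNodes inj s).filter fun p => ω (p, s) < a (s - p.1 + 1)

/-- The coins for which none of the first `T` slots is successful. -/
def quietEvent (a : ℕ → unitInterval) (inj : ℕ → ℕ) (jm : ℕ → Bool) (T : ℕ) : Set Coins :=
  {ω | ∀ s ∈ Finset.Icc 1 T, jm s = false → (quietSenders a inj ω s).card ≠ 1}

lemma mem_injectedNodes {inj : ℕ → ℕ} {s : ℕ} {p : NodeId} :
    p ∈ injectedNodes inj s ↔ 1 ≤ p.1 ∧ p.1 ≤ s ∧ p.2 < inj p.1 := by
  obtain ⟨u, j⟩ := p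
  simp only [injectedNodes, Finset.mem_biUnion, Finset.mem_Icc, Finset.mem_image,
    Finset.mem_range, Prod.mk.injEq]
  constructor
  · rintro ⟨v, hv, k, hk, rfl, rfl⟩
    exact ⟨hv.1, hv.2, hk⟩
  · rintro ⟨h1, h2, h3⟩
    exact ⟨u, ⟨h1, h2⟩, j, h3, rfl, rfl⟩

lemma injectedNodes_succ (inj : ℕ → ℕ) (T : ℕ) :
    injectedNodes inj (T + 1) =
      injectedNodes inj T ∪ (Finset.range (inj (T + 1))).image fun j => (T + 1, j) := by
  ext ⟨u, j⟩
  simp only [mem_injectedNodes, Finset.mem_union, Finset.mem_image, Finset.mem_range,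
    Prod.mk.injEq]
  constructor
  · rintro ⟨h1, h2, h3⟩
    rcases Nat.lt_or_ge T u with h | h
    · obtain rfl : u = T + 1 := by omega
      exact Or.inr ⟨j, h3, rfl, rfl⟩
    · exact Or.inl ⟨h1, h, h3⟩
  · rintro (⟨h1, h2, h3⟩ | ⟨k, hk, rfl, rfl⟩)
    · exact ⟨h1, by omega, h3⟩
    · exact ⟨by omega, le_rfl, hk⟩

/-- The state after `T` slots without success, as far as it matters to the nodes. -/
structure QuietState (inj : ℕ → ℕ) (T : ℕ) (st : ChannelState) : Prop where
  feedback_length : st.feedback.length = T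
  alive : st.alive = injectedNodes inj T
  records_future : ∀ p : NodeId, T < p.1 → st.records p = []
  records_length : ∀ p ∈ injectedNodes inj T, (st.records p).length + p.1 = T + 1
  records_quiet : ∀ p ∈ injectedNodes inj T, ∀ r ∈ st.records p, r.heardSuccess = false

/-- The counters after `T` slots against an oblivious adversary, if no slot before the last was
successful. -/
structure QuietCounts (inj : ℕ → ℕ) (jm : ℕ → Bool) (T : ℕ) (st : ChannelState) : Prop where
  arrivals : st.arrivals = ∑ s ∈ Finset.Icc 1 T, inj s
  jammed : st.jammed = ∑ s ∈ Finset.Icc 1 T, if jm s then 1 else 0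
  active : ∀ v, 1 ≤ v → 0 < inj v → T + 1 ≤ st.active + v

section
variable {A : Algorithm} {a : ℕ → unitInterval} {inj : ℕ → ℕ} {jm : ℕ → Bool} {T : ℕ}
  {st : ChannelState}

lemma QuietState.present_eq (h : QuietState inj T st) :
    st.present (obliviousAdversary inj jm) (T + 1) = injectedNodes inj (T + 1) := by
  simp [ChannelState.present, obliviousAdversary, h.feedback_length, h.alive, injectedNodes_succ]

lemma QuietState.senders_eq (hA : A.NonAdaptiveBeforeSuccess a) (h : QuietState inj T st)
    (ω : Coins) :
    st.senders A (obliviousAdversary inj jm) ω (T + 1) = quietSenders a inj ω (T + 1) := by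
  rw [ChannelState.senders, quietSenders, h.present_eq]
  refine Finset.filter_congr fun p hp => ?_
  have key : A.sendProb (st.records p) = a (T + 1 - p.1 + 1) := by
    rw [mem_injectedNodes] at hp
    rcases Nat.lt_or_ge T p.1 with hT | hT
    · rw [h.records_future p hT, hA _ (by simp)]
      congr 1
      simp only [List.length_nil]
      omega
    · have hm : p ∈ injectedNodes inj T := mem_injectedNodes.2 ⟨hp.1, hT, hp.2.2⟩
      rw [hA _ (h.records_quiet p hm)]
      congr 1
      have := h.records_length p hm
      omega
  rw [key]

lemma QuietState.success_eq (hA : A.NonAdaptiveBeforeSuccess a) (h : QuietState inj T st)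
    {ω : Coins} (hq : jm (T + 1) = false → (quietSenders a inj ω (T + 1)).card ≠ 1) :
    st.success A (obliviousAdversary inj jm) ω (T + 1) = false := by
  rw [ChannelState.success, h.senders_eq hA]
  have : (obliviousAdversary inj jm).jam st.feedback = jm (T + 1) := by
    simp [obliviousAdversary, h.feedback_length]
  rw [this]
  cases hj : jm (T + 1)
  · simpa using hq hj
  · simp

lemma QuietState.step (hA : A.NonAdaptiveBeforeSuccess a) (h : QuietState inj T st)
    {ω : Coins} (hq : jm (T + 1) = false → (quietSenders a inj ω (T + 1)).card ≠ 1) :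
    QuietState inj (T + 1) (st.step A (obliviousAdversary inj jm) ω (T + 1)) := by
  have hs := h.success_eq hA hq
  have hlen : ∀ p ∈ injectedNodes inj (T + 1), (st.records p).length + p.1 = T + 1 := by
    intro p hp
    rcases Nat.lt_or_ge T p.1 with hT | hT
    · rw [h.records_future p hT]
      have := (mem_injectedNodes.1 hp).2.1
      simp only [List.length_nil]
      omega
    · obtain ⟨h1, -, h2⟩ := mem_injectedNodes.1 hp
      exact h.records_length p (mem_injectedNodes.2 ⟨h1, hT, h2⟩)
  have hquiet : ∀ p ∈ injectedNodes inj (T + 1), ∀ r ∈ st.records p,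
      r.heardSuccess = false := by
    intro p hp
    rcases Nat.lt_or_ge T p.1 with hT | hT
    · simp [h.records_future p hT]
    · obtain ⟨h1, -, h2⟩ := mem_injectedNodes.1 hp
      exact h.records_quiet p (mem_injectedNodes.2 ⟨h1, hT, h2⟩)
  constructor
  · simp [ChannelState.step, h.feedback_length]
  · simp [ChannelState.step, hs, h.present_eq]
  · intro p hp
    have hn : p ∉ injectedNodes inj (T + 1) := fun hm => by
      have := (mem_injectedNodes.1 hm).2.1
      omega
    simp [ChannelState.step, h.present_eq, hn, h.records_future p (by omega)]
  · intro p hp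
    have := hlen p hp
    simp only [ChannelState.step, h.present_eq, hp, if_true, List.length_cons]
    omega
  · intro p hp r hr
    simp only [ChannelState.step, h.present_eq, hp, if_true, List.mem_cons] at hr
    rcases hr with rfl | hr
    · exact hs
    · exact hquiet p hp r hr

/-- Arrivals, jamming and activity of a slot are settled before its outcome, so slot `T + 1` itself
may succeed. Hence the bound can be tested at `t + 1` when only `t` slots are known to be quiet. -/
lemma QuietCounts.step (A : Algorithm) (h : QuietState inj T st) (hc : QuietCounts inj jm T st)
    (ω : Coins) :
    QuietCounts inj jm (T + 1) (st.step A (obliviousAdversary inj jm) ω (T + 1)) := by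
  constructor
  · rw [Finset.sum_Icc_succ_top (by omega), ← hc.arrivals]
    simp [ChannelState.step, obliviousAdversary, h.feedback_length]
  · rw [Finset.sum_Icc_succ_top (by omega), ← hc.jammed]
    simp [ChannelState.step, obliviousAdversary, h.feedback_length]
  · intro v hv hi
    have := hc.active v hv hi
    simp only [ChannelState.step, h.present_eq]
    rcases Nat.lt_or_ge (T + 1) v with hT | hT
    · omega
    · have hne : (injectedNodes inj (T + 1)).Nonempty :=
        ⟨(v, 0), mem_injectedNodes.2 ⟨hv, hT, hi⟩⟩
      rw [if_pos hne]
      omega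

lemma quietState_execution (hA : A.NonAdaptiveBeforeSuccess a) {ω : Coins} :
    ∀ T, ω ∈ quietEvent a inj jm T →
      QuietState inj T (execution A (obliviousAdversary inj jm) ω T) ∧
      QuietCounts inj jm T (execution A (obliviousAdversary inj jm) ω T)
  | 0, _ => by
    refine ⟨⟨rfl, ?_, fun _ _ => rfl, ?_, ?_⟩, ⟨rfl, rfl, fun v hv _ => ?_⟩⟩
    · simp [execution, ChannelState.initial, injectedNodes]
    · simp [injectedNodes]
    · simp [injectedNodes]
    · omega
  | T + 1, h => by
    obtain ⟨h1, h2⟩ := quietState_execution hA T fun s hs =>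
      h s (Finset.mem_Icc.2 ⟨(Finset.mem_Icc.1 hs).1, by have := (Finset.mem_Icc.1 hs).2; omega⟩)
    exact ⟨h1.step hA (h (T + 1) (by simp)), h2.step A h1 ω⟩

/-- If the throughput bound fails in the absence of a success before slot `t`, then an algorithm
that achieves the throughput has a success before slot `t` with high probability. -/
lemma measure_quietEvent_le {f g : ℝ → ℝ} (hA : A.NonAdaptiveBeforeSuccess a)
    (hthr : A.AchievesThroughput f g) (inj : ℕ → ℕ) (jm : ℕ → Bool) (t v n : ℕ)
    (hv : 1 ≤ v) (hinj : 0 < inj v) (hn : 1 ≤ n) (hsum : ∑ s ∈ Finset.Icc 1 (t + 1), inj s = n)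
    (hb : (n : ℝ) * f (t + 1 : ℕ) +
      ((∑ s ∈ Finset.Icc 1 (t + 1), if jm s then 1 else 0 : ℕ) : ℝ) * g (t + 1 : ℕ) + v
        < (t + 1 : ℕ) + 1) :
    coinMeasure (quietEvent a inj jm t) ≤ ENNReal.ofReal (1 / n) := by
  obtain ⟨c, hc, hthr⟩ := hthr
  calc coinMeasure (quietEvent a inj jm t)
      ≤ _ := measure_mono ?_
    _ ≤ _ := hthr (t + 1) (by omega) (obliviousAdversary inj jm) n hn
    _ ≤ _ := ?_
  · intro ω hω
    obtain ⟨h1, h2⟩ := quietState_execution (A := A) hA t hω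
    have h3 := h2.step A h1 ω
    change QuietCounts inj jm (t + 1) (execution A (obliviousAdversary inj jm) ω (t + 1)) at h3
    refine ⟨h3.arrivals.trans hsum, ?_⟩
    rw [h3.jammed]
    have h4 : ((t + 1 + 1 : ℕ) : ℝ) ≤ _ := Nat.cast_le.2 (h3.active v hv hinj)
    push_cast at h4 hb ⊢
    linarith
  · have h1 : (1 : ℝ) ≤ n := by exact_mod_cast hn
    refine ENNReal.ofReal_le_ofReal (one_div_le_one_div_of_le (by linarith) ?_)
    exact (Real.rpow_one (n : ℝ)).symm.le.trans (Real.rpow_le_rpow_of_exponent_le h1 hc)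

end

/-! ### Probabilities of boxes -/

lemma coinMeasure_box (F : Finset (NodeId × ℕ)) (E : NodeId × ℕ → Set unitInterval)
    (hE : ∀ i, MeasurableSet (E i)) :
    coinMeasure {ω | ∀ i ∈ F, ω i ∈ E i} = ∏ i ∈ F, volume (E i) :=
  Measure.infinitePi_pi (fun _ : NodeId × ℕ => (volume : Measure unitInterval))
    (s := F) (t := E) fun i _ => hE i

instance : IsProbabilityMeasure coinMeasure := by
  unfold coinMeasure
  infer_instance

/-! ### Few nodes have to broadcast often -/

/-- Coins of a node that broadcasts with probability `p` which make it do the more likely thing. -/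
def likelyCoins (p : unitInterval) : Set unitInterval :=
  if (p : ℝ) ≤ 1 / 2 then Ici p else Iio p

lemma measurableSet_likelyCoins (p : unitInterval) : MeasurableSet (likelyCoins p) := by
  unfold likelyCoins
  split_ifs
  · exact measurableSet_Ici
  · exact measurableSet_Iio

/-- The likelier action has probability `max p (1 - p) ≥ 1 / (1 + 2 * p) ≥ exp (-2 * p)`. -/
lemma le_volume_likelyCoins (p : unitInterval) :
    ENNReal.ofReal (Real.exp (-2 * p)) ≤ volume (likelyCoins p) := by
  have h0 : (0 : ℝ) ≤ p := p.2.1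
  have hmul : Real.exp (-2 * p) * Real.exp (2 * p) = 1 := by
    rw [← Real.exp_add]; simp
  have hle : Real.exp (-2 * p) ≤ 1 / (1 + 2 * p) := by
    rw [le_div_iff₀ (by linarith)]
    have := Real.add_one_le_exp (2 * (p : ℝ))
    nlinarith [Real.exp_pos (-2 * (p : ℝ))]
  unfold likelyCoins
  split_ifs with h
  · rw [unitInterval.volume_Ici]
    refine ENNReal.ofReal_le_ofReal (hle.trans ?_)
    rw [div_le_iff₀ (by linarith)]
    nlinarith
  · rw [unitInterval.volume_Iio]
    refine ENNReal.ofReal_le_ofReal (hle.trans ?_)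
    rw [div_le_iff₀ (by linarith)]
    nlinarith

/-- If the throughput bound fails for two nodes that are jammed in the first `r` slots, then their
broadcasting probabilities in the slots after that have a large sum: many nodes injected in the
last slot reduce the admissible error. -/
lemma log_le_sum_of_throughput {A : Algorithm} {a : ℕ → unitInterval} {f g : ℝ → ℝ}
    (hA : A.NonAdaptiveBeforeSuccess a) (hthr : A.AchievesThroughput f g) (r t N : ℕ)
    (ht : 1 ≤ t) (hr : r ≤ t)
    (hb : ((2 + N : ℕ) : ℝ) * f (t + 1 : ℕ) + r * g (t + 1 : ℕ) < (t + 1 : ℕ)) :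
    Real.log (2 + N : ℕ) ≤ 4 * ∑ i ∈ Finset.Ioc r t, (a i : ℝ) := by
  set inj : ℕ → ℕ := fun u => if u = 1 then 2 else if u = t + 1 then N else 0 with hinj
  set jm : ℕ → Bool := fun s => decide (s ≤ r) with hjm
  have hsum : ∑ s ∈ Finset.Icc 1 (t + 1), inj s = 2 + N := by
    rw [Finset.sum_Icc_succ_top (by omega)]
    congr 1
    · rw [Finset.sum_eq_single_of_mem 1 (by simp [ht])]
      · simp [hinj]
      · intro b hb hb1
        have := (Finset.mem_Icc.1 hb).2
        simp only [hinj, hb1, if_false]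
        rw [if_neg (by omega)]
    · simp only [hinj]
      rw [if_neg (by omega), if_pos trivial]
  have hjsum : (∑ s ∈ Finset.Icc 1 (t + 1), if jm s then 1 else 0 : ℕ) = r := by
    rw [← Finset.card_filter]
    have : (Finset.Icc 1 (t + 1)).filter (fun s => jm s = true) = Finset.Icc 1 r := by
      ext s
      simp only [hjm, Finset.mem_filter, Finset.mem_Icc, decide_eq_true_eq]
      omega
    rw [this]
    simp
  have hmeas := measure_quietEvent_le hA hthr inj jm t 1 (2 + N) le_rfl (by simp [hinj])
    (by omega) hsum (by rw [hjsum]; push_cast at hb ⊢; linarith)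
  set F : Finset (NodeId × ℕ) :=
    (Finset.range 2 ×ˢ Finset.Ioc r t).image fun x => ((1, x.1), x.2) with hF
  set E : NodeId × ℕ → Set unitInterval := fun i => likelyCoins (a i.2) with hE
  -- Both nodes have the same age, hence the same likelier action: zero or two of them broadcast,
  -- never one. The `N` late nodes are absent up to slot `t`.
  have hbox : {ω : Coins | ∀ i ∈ F, ω i ∈ E i} ⊆ quietEvent a inj jm t := by
    intro ω hω s hs hj
    have hs' := Finset.mem_Icc.1 hs
    have hrs : r < s := by simpa [hjm] using hj
    have hmem : ∀ j < 2, ω ((1, j), s) ∈ likelyCoins (a s) := by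
      intro j hj
      refine hω ((1, j), s) ?_
      rw [hF, Finset.mem_image]
      exact ⟨(j, s), by simp [hj, hrs, hs'.2], rfl⟩
    have hnodes : injectedNodes inj s = (Finset.range 2).image fun j => (1, j) := by
      ext ⟨u, j⟩
      simp only [mem_injectedNodes, Finset.mem_image, Finset.mem_range, Prod.mk.injEq]
      constructor
      · rintro ⟨h1, h2, h3⟩
        by_cases hu : u = 1
        · subst hu
          exact ⟨j, by simpa [hinj] using h3, rfl, rfl⟩
        · rw [hinj] at h3
          simp only [hu, if_false] at h3
          rw [if_neg (by omega)] at h3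
          omega
      · rintro ⟨k, hk, rfl, rfl⟩
        exact ⟨le_rfl, hs'.1, by simpa [hinj] using hk⟩
    have hage : s - 1 + 1 = s := by omega
    by_cases hp : (a s : ℝ) ≤ 1 / 2
    · have : quietSenders a inj ω s = ∅ := by
        rw [quietSenders, hnodes, Finset.filter_eq_empty_iff]
        intro p hp'
        obtain ⟨j, hj, rfl⟩ := Finset.mem_image.1 hp'
        have := hmem j (Finset.mem_range.1 hj)
        rw [likelyCoins, if_pos hp] at this
        simpa [hage] using this
      simp [this]
    · have : quietSenders a inj ω s = (Finset.range 2).image fun j => (1, j) := by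
        rw [quietSenders, hnodes, Finset.filter_eq_self]
        intro p hp'
        obtain ⟨j, hj, rfl⟩ := Finset.mem_image.1 hp'
        have := hmem j (Finset.mem_range.1 hj)
        rw [likelyCoins, if_neg hp] at this
        simpa [hage] using this
      rw [this, Finset.card_image_of_injective _ (fun x y h => (Prod.mk.inj h).2)]
      simp
  have hle := (measure_mono hbox).trans hmeas
  rw [coinMeasure_box F E fun i => measurableSet_likelyCoins _] at hle
  have hlow := (Finset.prod_le_prod' fun i _ => le_volume_likelyCoins (a i.2)).trans hle
  rw [← ENNReal.ofReal_prod_of_nonneg fun i _ => (Real.exp_pos _).le, ← Real.exp_sum,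
    ← Finset.mul_sum, hF, Finset.sum_image (by
      rintro ⟨x, y⟩ - ⟨x', y'⟩ - h
      simp only [Prod.mk.injEq, true_and] at h
      simp [h.1, h.2]), Finset.sum_product] at hlow
  have hpos : (0 : ℝ) < (2 + N : ℕ) := by positivity
  rw [ENNReal.ofReal_le_ofReal_iff (by positivity)] at hlow
  have := Real.log_le_log (Real.exp_pos _) hlow
  rw [Real.log_exp, one_div, Real.log_inv] at this
  simp only [Finset.sum_const, Finset.card_range, nsmul_eq_mul] at this
  push_cast at this ⊢
  linarith

/-- The broadcasting probabilities have a sum of at least `log (r * q) / 8` over the ages between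
`r` and `r * q`, if the throughput allows for `r` jammed slots among `r * q`. -/
lemma log_le_sum_Ioc {A : Algorithm} {a : ℕ → unitInterval} {f g : ℝ → ℝ}
    (hA : A.NonAdaptiveBeforeSuccess a) (hthr : A.AchievesThroughput f g)
    (hf_pos : ∀ x : ℝ, 0 < x → 0 < f x) (hf : f =O[atTop] Real.log) :
    ∃ s₀ : ℕ, ∀ r q : ℕ, s₀ ≤ r * q → 2 ≤ q → 4 * g (r * q : ℕ) ≤ q →
      Real.log (r * q : ℕ) / 8 ≤ ∑ i ∈ Finset.Ioc r (r * q), (a i : ℝ) := by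
  -- The bound `f s ≤ √s / 8` gives `s / (2 * f s) ≥ 4 * √s`, so the number `n` of nodes is at least
  -- `√s` even after rounding, and `log n ≥ log s / 2`.
  have hsmall : f =o[atTop] fun x : ℝ => x ^ (1 / 2 : ℝ) :=
    hf.trans_isLittleO (isLittleO_log_rpow_atTop (by norm_num))
  have h1 := tendsto_natCast_atTop_atTop (R := ℝ) |>.eventually
    (hsmall.bound (show (0 : ℝ) < 1 / 8 by norm_num))
  obtain ⟨s₀, hs₀⟩ := eventually_atTop.1 h1
  refine ⟨max s₀ 2, fun r q hs hq hg => ?_⟩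
  obtain ⟨t, ht⟩ : ∃ t, r * q = t + 1 := ⟨r * q - 1, by have := le_max_right s₀ 2; omega⟩
  have hr1 : 1 ≤ r := by
    rcases Nat.eq_zero_or_pos r with h | h
    · simp [h] at ht
    · exact h
  have ht1 : 1 ≤ t := by have := le_max_right s₀ 2; omega
  have hrt : r ≤ t := by nlinarith
  have hf1 := hs₀ (r * q) ((le_max_left _ _).trans hs)
  rw [ht] at hf1 hg ⊢
  set s : ℝ := ((t + 1 : ℕ) : ℝ) with hs_def
  have hsge : (2 : ℝ) ≤ s := by rw [hs_def]; exact_mod_cast (by omega : 2 ≤ t + 1)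
  have hfp : 0 < f s := hf_pos s (by linarith)
  rw [Real.norm_of_nonneg hfp.le, Real.norm_of_nonneg (by positivity), ← Real.sqrt_eq_rpow] at hf1
  have hsq : Real.sqrt s * Real.sqrt s = s := Real.mul_self_sqrt (by linarith)
  have hsq1 : 1 ≤ Real.sqrt s := by rw [Real.one_le_sqrt]; linarith
  -- The nodes pay for at most `s / 2` active slots and the `r` jams for at most `r * q / 4 = s /
  -- 4`, together fewer than `s`.
  set n : ℕ := ⌊s / (2 * f s)⌋₊ with hn
  have hn1 : (n : ℝ) ≤ s / (2 * f s) := Nat.floor_le (by positivity)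
  have hn2 : s / (2 * f s) < n + 1 := Nat.lt_floor_add_one _
  have hn3 : 4 * Real.sqrt s ≤ s / (2 * f s) := by
    rw [le_div_iff₀ (by positivity)]
    nlinarith
  have hn4 : Real.sqrt s ≤ n := by linarith
  have hn5 : 2 ≤ n := by
    have : (2 : ℝ) ≤ n := by linarith
    exact_mod_cast this
  obtain ⟨N, hN⟩ := Nat.exists_eq_add_of_le hn5
  have hrq : (r : ℝ) * q = s := by rw [hs_def, ← ht]; push_cast; rfl
  have hr0 : (0 : ℝ) ≤ r := by positivity
  have key := log_le_sum_of_throughput hA hthr r t N ht1 hrt (by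
    rw [← hN]
    rw [le_div_iff₀ (by positivity)] at hn1
    change (n : ℝ) * f s + r * g s < s
    nlinarith)
  rw [← hN] at key
  have hlog : Real.log s / 2 ≤ Real.log n := by
    rw [← Real.log_sqrt (by linarith)]
    exact Real.log_le_log (by linarith) hn4
  have hmono : ∑ i ∈ Finset.Ioc r t, (a i : ℝ) ≤ ∑ i ∈ Finset.Ioc r (t + 1), (a i : ℝ) :=
    Finset.sum_le_sum_of_subset_of_nonneg (Finset.Ioc_subset_Ioc_right (by omega))
      fun i _ _ => (a i).2.1
  linarith

/-- Summing over `k` windows with ratio `q`. -/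
lemma mul_log_le_sum_Ioc {A : Algorithm} {a : ℕ → unitInterval} {f g : ℝ → ℝ}
    (hA : A.NonAdaptiveBeforeSuccess a) (hthr : A.AchievesThroughput f g)
    (hf_pos : ∀ x : ℝ, 0 < x → 0 < f x) (hf : f =O[atTop] Real.log) :
    ∃ s₀ : ℕ, ∀ z q k : ℕ, s₀ ≤ z → 1 ≤ z → 2 ≤ q →
      (∀ s : ℕ, 1 ≤ s → s ≤ z * q ^ k → 4 * g s ≤ q) →
      k * (Real.log z / 8) ≤ ∑ i ∈ Finset.Ioc 0 (z * q ^ k), (a i : ℝ) := by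
  obtain ⟨s₀, hs₀⟩ := log_le_sum_Ioc (g := g) hA hthr hf_pos hf
  refine ⟨s₀, fun z q k hz hz1 hq => ?_⟩
  induction k with
  | zero =>
    intro _
    simpa using Finset.sum_nonneg fun i _ => (a i).2.1
  | succ k ih =>
    intro hg
    have hpow : z * q ^ (k + 1) = z * q ^ k * q := by ring
    have hpos : 1 ≤ q ^ k := Nat.one_le_pow _ _ (by omega)
    have h1 : z ≤ z * q ^ k := Nat.le_mul_of_pos_right _ hpos
    have h2 : z * q ^ k ≤ z * q ^ k * q := Nat.le_mul_of_pos_right _ (by omega)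
    have h3 := ih fun s hs hs' => hg s hs (by omega)
    have h4 := hs₀ (z * q ^ k) q (by omega) hq (hg _ (by omega) (by omega))
    have h5 : Real.log z ≤ Real.log (z * q ^ k * q : ℕ) :=
      Real.log_le_log (by exact_mod_cast hz1) (by exact_mod_cast h1.trans h2)
    rw [hpow, ← Finset.sum_Ioc_consecutive _ (Nat.zero_le _) h2]
    push_cast at h3 h4 h5 ⊢
    linarith

/-! ### Many nodes that arrive at random times -/

/-- The broadcasting probability in slot `s` of a node injected in slot `u`, before any success. -/
def sendProbAt (a : ℕ → unitInterval) (s u : ℕ) : unitInterval :=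
  if u ≤ s then a (s - u + 1) else 0

/-- One node in each of the slots `τ b`. -/
def injectAt {ι : Type*} [Fintype ι] (τ : ι → ℕ) (u : ℕ) : ℕ :=
  if u ∈ Finset.univ.image τ then 1 else 0

/-- The probability that of independent events with probabilities `p b` exactly one occurs. -/
def exactlyOne {ι : Type*} [Fintype ι] [DecidableEq ι] (p : ι → ℝ) : ℝ :=
  ∑ b, ∏ b', if b' = b then p b' else 1 - p b'

/-- With `P = ∑ b, p b`, the bound `1 - p ≤ exp (-p)` controls the `b`-th term by `p b * e * exp
(-P)`, where `e` makes up for the missing factor of `b`. Then `P * exp (-P / 2) ≤ 2`. -/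
lemma exactlyOne_le {ι : Type*} [Fintype ι] [DecidableEq ι] (p : ι → ℝ) (h0 : ∀ b, 0 ≤ p b)
    (h1 : ∀ b, p b ≤ 1) :
    exactlyOne p ≤ 2 * Real.exp 1 * Real.exp (-(∑ b, p b) / 2) := by
  have hterm : ∀ b, (∏ b', if b' = b then p b' else 1 - p b') ≤
      p b * (Real.exp 1 * Real.exp (-∑ b, p b)) := by
    intro b
    calc (∏ b', if b' = b then p b' else 1 - p b')
        ≤ ∏ b', (if b' = b then p b' * Real.exp 1 else 1) * Real.exp (-p b') := by
          refine Finset.prod_le_prod (fun i _ => ?_) fun i _ => ?_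
          · split_ifs
            · exact h0 i
            · linarith [h1 i]
          · split_ifs
            · rw [mul_assoc, ← Real.exp_add]
              have := Real.add_one_le_exp (1 + -p i)
              nlinarith [h0 i, h1 i]
            · simpa using Real.one_sub_le_exp_neg (p i)
      _ = _ := by
          rw [Finset.prod_mul_distrib, Finset.prod_ite_eq' Finset.univ b, if_pos (Finset.mem_univ b),
            ← Real.exp_sum, Finset.sum_neg_distrib, mul_assoc]
  calc exactlyOne p ≤ ∑ b, p b * (Real.exp 1 * Real.exp (-∑ b, p b)) :=
        Finset.sum_le_sum fun b _ => hterm b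
    _ = Real.exp 1 * ((∑ b, p b) * Real.exp (-∑ b, p b)) := by rw [← Finset.sum_mul]; ring
    _ ≤ _ := by
        set P := ∑ b, p b
        have hP := Real.add_one_le_exp (P / 2)
        have h2 : Real.exp (-P) = Real.exp (-P / 2) * Real.exp (-P / 2) := by
          rw [← Real.exp_add]; ring_nf
        have h3 : Real.exp (P / 2) * Real.exp (-P / 2) = 1 := by
          rw [← Real.exp_add]; ring_nf; simp
        have h4 : P * Real.exp (-P) ≤ 2 * Real.exp (-P / 2) := by
          rw [h2]
          have h5 := Real.exp_pos (-P / 2)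
          have h6 : P * Real.exp (-P / 2) ≤ 2 := by nlinarith
          nlinarith
        nlinarith [Real.exp_pos 1]

lemma exactlyOne_nonneg {ι : Type*} [Fintype ι] [DecidableEq ι] (p : ι → ℝ) (h0 : ∀ b, 0 ≤ p b)
    (h1 : ∀ b, p b ≤ 1) : 0 ≤ exactlyOne p := by
  refine Finset.sum_nonneg fun b _ => Finset.prod_nonneg fun i _ => ?_
  split_ifs
  · exact h0 i
  · linarith [h1 i]

/-- Averaging over independent uniform choices of the arguments commutes with `exactlyOne`. -/
lemma sum_exactlyOne {m L : ℕ} (hL : 0 < L) (w : Fin m → Fin L → ℝ) :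
    ∑ o : Fin m → Fin L, exactlyOne (fun b => w b (o b)) =
      (L : ℝ) ^ m * exactlyOne fun b => (∑ k, w b k) / L := by
  have hL' : (L : ℝ) ≠ 0 := by positivity
  unfold exactlyOne
  rw [Finset.sum_comm, Finset.mul_sum]
  refine Finset.sum_congr rfl fun b _ => ?_
  -- Each factor depends on a single coordinate of `o`, so the sum over `o` factorises by
  -- distributivity.
  have := Finset.prod_univ_sum (fun _ : Fin m => (Finset.univ : Finset (Fin L)))
    fun b' k => if b' = b then w b' k else 1 - w b' k
  rw [Fintype.piFinset_univ] at this
  rw [← this]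
  have hc : (L : ℝ) ^ m = ∏ _b : Fin m, (L : ℝ) := by simp
  rw [hc, ← Finset.prod_mul_distrib]
  refine Finset.prod_congr rfl fun b' _ => ?_
  split_ifs
  · field_simp
  · rw [Finset.sum_sub_distrib]
    simp
    field_simp

/-- Union bound over the sole sender, each case being a box of coins. Nodes yet to arrive fit in as
nodes with probability `0`. -/
lemma measure_card_quietSenders_eq_one_le {ι : Type*} [Fintype ι] [DecidableEq ι]
    (a : ℕ → unitInterval) (τ : ι → ℕ) (hτ : Function.Injective τ) (hτ1 : ∀ b, 1 ≤ τ b) (s : ℕ) :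
    coinMeasure {ω | (quietSenders a (injectAt τ) ω s).card = 1} ≤
      ENNReal.ofReal (exactlyOne fun b => (sendProbAt a s (τ b) : ℝ)) := by
  set idx : ι → NodeId × ℕ := fun b => ((τ b, 0), s) with hidx
  have hidx_inj : Function.Injective idx := fun b b' h => hτ (by simpa [hidx] using h)
  set E : ι → NodeId × ℕ → Set unitInterval := fun b i =>
    if i.1.1 = τ b then Iio (sendProbAt a s i.1.1) else Ici (sendProbAt a s i.1.1) with hE
  have hmem : ∀ ω : Coins, ∀ b, ((τ b, 0) : NodeId) ∈ quietSenders a (injectAt τ) ω s ↔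
      ω (idx b) < sendProbAt a s (τ b) := by
    intro ω b
    simp only [quietSenders, Finset.mem_filter, mem_injectedNodes, injectAt, sendProbAt, hidx]
    split_ifs with h1 h2 h2
    · simp [hτ1 b, h2]
    · have : ¬ ω ((τ b, 0), s) < 0 := not_lt.2 (ω _).2.1
      simp [h2, this]
    · exact absurd (Finset.mem_image_of_mem τ (Finset.mem_univ b)) h1
    · exact absurd (Finset.mem_image_of_mem τ (Finset.mem_univ b)) h1
  have hsub : {ω | (quietSenders a (injectAt τ) ω s).card = 1} ⊆
      ⋃ b, {ω : Coins | ∀ i ∈ Finset.univ.image idx, ω i ∈ E b i} := by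
    intro ω hω
    obtain ⟨p, hp⟩ := Finset.card_eq_one.1 hω
    have hpm : p ∈ quietSenders a (injectAt τ) ω s := by simp [hp]
    obtain ⟨u, j⟩ := p
    have hin := (mem_injectedNodes.1 (Finset.mem_filter.1 hpm).1).2.2
    simp only [injectAt] at hin
    split_ifs at hin with hu
    · obtain ⟨b, -, rfl⟩ := Finset.mem_image.1 hu
      obtain rfl : j = 0 := by omega
      refine mem_iUnion.2 ⟨b, fun i hi => ?_⟩
      obtain ⟨b', -, rfl⟩ := Finset.mem_image.1 hi
      simp only [hE, hidx]
      split_ifs with hb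
      · have hb' : b' = b := hτ hb
        subst hb'
        exact (hmem ω b').1 hpm
      · refine mem_Ici.2 (le_of_not_gt fun hlt => hb ?_)
        have h2 := (hmem ω b').2 hlt
        rw [hp, Finset.mem_singleton] at h2
        exact (Prod.mk.inj h2).1
    · omega
  refine (measure_mono hsub).trans ((measure_iUnion_fintype_le _ _).trans ?_)
  rw [exactlyOne, ENNReal.ofReal_sum_of_nonneg]
  · refine Finset.sum_le_sum fun b _ => ?_
    rw [coinMeasure_box, Finset.prod_image hidx_inj.injOn, ENNReal.ofReal_prod_of_nonneg]
    · refine Finset.prod_le_prod' fun b' _ => ?_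
      simp only [hE, hidx, hτ.eq_iff]
      split_ifs
      · exact (unitInterval.volume_Iio _).le
      · exact (unitInterval.volume_Ici _).le
    · intro b' _
      split_ifs
      · exact (sendProbAt a s (τ b')).2.1
      · exact sub_nonneg.2 (sendProbAt a s (τ b')).2.2
    · intro i
      simp only [hE]
      split_ifs
      · exact measurableSet_Iio
      · exact measurableSet_Ici
  · intro b _
    refine Finset.prod_nonneg fun b' _ => ?_
    split_ifs
    · exact (sendProbAt a s (τ b')).2.1
    · exact sub_nonneg.2 (sendProbAt a s (τ b')).2.2

/-- The slots in which nodes arrive, one in each of `m` blocks of length `L`. -/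
def blockSlot {m L : ℕ} (o : Fin m → Fin L) (b : Fin m) : ℕ := b * L + o b + 1

lemma blockSlot_injective {m L : ℕ} (o : Fin m → Fin L) : Function.Injective (blockSlot o) := by
  intro b b' h
  have hL : 0 < L := (o b).pos
  have h1 : (b * L + o b : ℕ) / L = (b' * L + o b' : ℕ) / L := by
    unfold blockSlot at h
    congr 1
    omega
  rw [mul_comm, mul_comm (b' : ℕ), Nat.mul_add_div hL, Nat.mul_add_div hL,
    Nat.div_eq_of_lt (o b).2, Nat.div_eq_of_lt (o b').2] at h1
  exact Fin.ext (by simpa using h1)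

lemma blockSlot_le {m L : ℕ} (o : Fin m → Fin L) (b : Fin m) : blockSlot o b ≤ m * L := by
  have h1 := (o b).2
  have h2 : (b + 1 : ℕ) * L ≤ m * L := Nat.mul_le_mul_right _ b.2
  unfold blockSlot
  rw [add_mul] at h2
  omega

lemma sum_injectAt_blockSlot {m L : ℕ} (o : Fin m → Fin L) :
    ∑ s ∈ Finset.Icc 1 (m * L), injectAt (blockSlot o) s = m := by
  unfold injectAt
  rw [← Finset.card_filter, Finset.filter_mem_eq_inter, Finset.inter_eq_right.2,
    Finset.card_image_of_injective _ (blockSlot_injective o)]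
  · simp
  · intro u hu
    obtain ⟨b, -, rfl⟩ := Finset.mem_image.1 hu
    exact Finset.mem_Icc.2 ⟨by unfold blockSlot; omega, blockSlot_le o b⟩

lemma sum_range_mul_eq (h : ℕ → ℝ) (m L : ℕ) :
    ∑ b ∈ Finset.range m, ∑ k ∈ Finset.range L, h (b * L + k) =
      ∑ u ∈ Finset.range (m * L), h u := by
  induction m with
  | zero => simp
  | succ m ih => rw [Finset.sum_range_succ, ih, add_mul, one_mul, Finset.sum_range_add]

/-- As the arrival slot runs through `1, …, s`, the age in slot `s` takes each of these values once.
-/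
lemma sum_sendProbAt (a : ℕ → unitInterval) {s N : ℕ} (hs : s ≤ N) :
    ∑ u ∈ Finset.range N, (sendProbAt a s (u + 1) : ℝ) = ∑ i ∈ Finset.Ioc 0 s, (a i : ℝ) := by
  rw [← Finset.sum_subset (Finset.range_subset_range.2 hs)]
  · have hshift : ∀ n : ℕ, ∑ i ∈ Finset.Ioc 0 n, (a i : ℝ) =
        ∑ u ∈ Finset.range n, (a (u + 1) : ℝ) := by
      intro n
      induction n with
      | zero => simp
      | succ n ih => rw [Finset.sum_Ioc_succ_top (Nat.zero_le n), ih, Finset.sum_range_succ]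
    rw [hshift, ← Finset.sum_range_reflect]
    refine Finset.sum_congr rfl fun u hu => ?_
    have hus := Finset.mem_range.1 hu
    rw [sendProbAt, if_pos (by omega), show s - (s - 1 - u + 1) + 1 = u + 1 by omega]
  · intro u _ hu
    have : ¬ u + 1 ≤ s := by simpa using hu
    simp [sendProbAt, this]

/-- Nodes can arrive such that it is likely that no slot after slot `r` is successful, if
the broadcasting probabilities up to age `r` have a large sum. -/
lemma exists_blockSlot_quiet (a : ℕ → unitInterval) {m L r : ℕ} (hL : 0 < L) {B : ℝ}
    (hB : B * L ≤ ∑ i ∈ Finset.Ioc 0 r, (a i : ℝ)) :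
    ∃ o : Fin m → Fin L,
      coinMeasure (quietEvent a (injectAt (blockSlot o)) (fun s => decide (s ≤ r)) (m * L))ᶜ ≤
        ENNReal.ofReal ((m * L : ℕ) * (2 * Real.exp 1 * Real.exp (-B / 2))) := by
  have hL' : (0 : ℝ) < L := by exact_mod_cast hL
  have : Nonempty (Fin L) := ⟨⟨0, hL⟩⟩
  set δ : ℝ := 2 * Real.exp 1 * Real.exp (-B / 2) with hδ
  have hδ0 : 0 ≤ δ := by positivity
  set X : (Fin m → Fin L) → ℕ → ℝ := fun o s =>
    exactlyOne fun b => (sendProbAt a s (blockSlot o b) : ℝ) with hX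
  have hslot : ∀ s ∈ Finset.Ioc r (m * L), ∑ o, X o s ≤ (L : ℝ) ^ m * δ := by
    intro s hs
    obtain ⟨hs1, hs2⟩ := Finset.mem_Ioc.1 hs
    rw [show ∑ o, X o s = _ from sum_exactlyOne hL
      fun (b : Fin m) (k : Fin L) => (sendProbAt a s (b * L + k + 1) : ℝ)]
    refine mul_le_mul_of_nonneg_left ?_ (by positivity)
    refine (exactlyOne_le _ (fun b => ?_) fun b => ?_).trans ?_
    · exact div_nonneg (Finset.sum_nonneg fun k _ => (sendProbAt a s _).2.1) hL'.le
    · rw [div_le_one hL']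
      refine (Finset.sum_le_card_nsmul _ _ 1 fun k _ => (sendProbAt a s _).2.2).trans ?_
      simp
    · rw [hδ]
      -- Every slot up to `m * L` is an arrival slot with probability `1 / L`.
      have hsum : ∑ b : Fin m, (∑ k : Fin L, (sendProbAt a s (b * L + k + 1) : ℝ)) / L =
          (∑ i ∈ Finset.Ioc 0 s, (a i : ℝ)) / L := by
        rw [← Finset.sum_div, ← sum_sendProbAt a hs2, ← sum_range_mul_eq]
        simp only [Finset.sum_range]
      have hmono : ∑ i ∈ Finset.Ioc 0 r, (a i : ℝ) ≤ ∑ i ∈ Finset.Ioc 0 s, (a i : ℝ) :=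
        Finset.sum_le_sum_of_subset_of_nonneg (Finset.Ioc_subset_Ioc_right hs1.le)
          fun i _ _ => (a i).2.1
      have hBle : B ≤ (∑ i ∈ Finset.Ioc 0 s, (a i : ℝ)) / L := by
        rw [le_div_iff₀ hL']; linarith
      rw [hsum]
      gcongr
  -- Derandomisation: some placement does no worse than the average over all `L ^ m`.
  obtain ⟨o, -, ho⟩ : ∃ o ∈ (Finset.univ : Finset (Fin m → Fin L)),
      ∑ s ∈ Finset.Ioc r (m * L), X o s ≤ (m * L : ℕ) * δ := by
    refine Finset.exists_le_of_sum_le Finset.univ_nonempty ?_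
    rw [Finset.sum_comm]
    refine (Finset.sum_le_card_nsmul _ _ _ hslot).trans ?_
    simp only [Finset.sum_const, Finset.card_univ, Fintype.card_fun, Fintype.card_fin,
      nsmul_eq_mul, Nat.card_Ioc]
    have h1 : ((m * L - r : ℕ) : ℝ) ≤ (m * L : ℕ) := by exact_mod_cast Nat.sub_le _ _
    have h2 : 0 ≤ (L : ℝ) ^ m * δ := by positivity
    push_cast at h1 ⊢
    nlinarith
  refine ⟨o, ?_⟩
  have hsub : (quietEvent a (injectAt (blockSlot o)) (fun s => decide (s ≤ r)) (m * L))ᶜ ⊆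
      ⋃ s ∈ Finset.Ioc r (m * L),
        {ω | (quietSenders a (injectAt (blockSlot o)) ω s).card = 1} := by
    intro ω hω
    simp only [quietEvent, mem_compl_iff, mem_ofPred_eq, not_forall, not_not] at hω
    obtain ⟨s, hs, hj, hc⟩ := hω
    have hrs : r < s := by simpa using hj
    exact mem_biUnion (Finset.mem_coe.2 (Finset.mem_Ioc.2 ⟨hrs, (Finset.mem_Icc.1 hs).2⟩)) hc
  refine (measure_mono hsub).trans ((measure_biUnion_finset_le _ _).trans ?_)
  refine (Finset.sum_le_sum fun s _ => measure_card_quietSenders_eq_one_le a (blockSlot o)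
    (blockSlot_injective o) (fun b => by unfold blockSlot; omega) s).trans ?_
  rw [← ENNReal.ofReal_sum_of_nonneg fun s _ => exactlyOne_nonneg _
    (fun b => (sendProbAt a s _).2.1) fun b => (sendProbAt a s _).2.2]
  exact ENNReal.ofReal_le_ofReal ho

/-! ### The lower bound -/

set_option maxHeartbeats 1000000 in
/-- The asymptotic hypotheses, evaluated at one large number `z ^ 4`. -/
lemma exists_large_scale {f g : ℝ → ℝ} (hf_pos : ∀ x : ℝ, 0 < x → 0 < f x)
    (hg_pos : ∀ x : ℝ, 0 < x → 0 < g x)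
    (hf : SubLogarithmic f) (hg : SubLogarithmic fun x => Real.log (g x))
    (hfg : f =o[atTop] fun x => Real.log x / Real.log (g x)) (s₀ : ℕ) :
    ∃ z q L : ℕ, s₀ ≤ z ∧ 12 ≤ z ∧ 2 ≤ q ∧ 4 * g ((z : ℝ) ^ 4) ≤ q ∧ g ((z : ℝ) ^ 4) ≤ z ∧
      0 < L ∧ L ≤ 5 * z ∧ 4 * f ((z : ℝ) ^ 4) ≤ L ∧ 80 * L ≤ Nat.log q z := by
  obtain ⟨y, hy, X₁, hX₁⟩ := hf.eventually_ge
  obtain ⟨w, hw, X₂, hX₂⟩ := hg.eventually_ge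
  -- `C₁` and `C₂` absorb rounding and constants: `log q ≤ C₁ * log (g x)` and `L ≤ C₂ * f x`.
  set C₁ : ℝ := 1 + 2 / w with hC₁
  set C₂ : ℝ := 4 + 1 / y with hC₂
  have hC₁1 : 1 ≤ C₁ := by rw [hC₁]; have : 0 < 2 / w := by positivity
                           linarith
  have hC₂1 : 4 ≤ C₂ := by rw [hC₂]; have : 0 < 1 / y := by positivity
                           linarith
  -- From `f x * log (g x) ≤ 4 * ε * log z`, the three entries yield in turn `80 * L * log q ≤ log z
  -- / 2`, `C₁ * log (g x) ≤ log z / 2` and `f x ≤ log z`.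
  set ε : ℝ := min (1 / (640 * C₁ * C₂)) (min (y / (8 * C₁)) (w / 4)) with hε
  have hε0 : 0 < ε := by positivity
  have hε1 : ε * (640 * C₁ * C₂) ≤ 1 := by
    rw [← le_div_iff₀ (by positivity)]; exact min_le_left _ _
  have hε2 : ε * (8 * C₁) ≤ y := by
    rw [← le_div_iff₀ (by positivity)]; exact (min_le_right _ _).trans (min_le_left _ _)
  have hε3 : ε * 4 ≤ w := by
    rw [← le_div_iff₀ (by positivity)]; exact (min_le_right _ _).trans (min_le_right _ _)
  obtain ⟨X₃, hX₃⟩ := eventually_atTop.1 (hfg.bound hε0)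
  obtain ⟨Z, hZ⟩ := exists_nat_ge (max X₁ (max X₂ X₃))
  set z : ℕ := max (max s₀ 12) Z with hz
  have hz12 : 12 ≤ z := (le_max_right _ _).trans (le_max_left _ _)
  have hzs : s₀ ≤ z := (le_max_left _ _).trans (le_max_left _ _)
  have hzZ : Z ≤ z := le_max_right _ _
  clear_value z ε
  have hz12' : (12 : ℝ) ≤ z := by exact_mod_cast hz12
  have hzx : (z : ℝ) ≤ (z : ℝ) ^ 4 := le_self_pow₀ (by linarith) (by norm_num)
  set x : ℝ := (z : ℝ) ^ 4 with hx
  have hx0 : 0 < x := by positivity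
  have hmax : max X₁ (max X₂ X₃) ≤ x :=
    hZ.trans ((Nat.cast_le.2 hzZ).trans hzx)
  have hfx : y ≤ f x := hX₁ x ((le_max_left _ _).trans hmax)
  have hgx : w ≤ Real.log (g x) := hX₂ x (((le_max_left _ _).trans (le_max_right _ _)).trans hmax)
  have hfgx := hX₃ x (((le_max_right _ _).trans (le_max_right _ _)).trans hmax)
  set ℓ : ℝ := Real.log z with hℓ
  have hℓ0 : 0 < ℓ := Real.log_pos (by linarith)
  have hlogx : Real.log x = 4 * ℓ := by rw [hx, Real.log_pow]; norm_num [hℓ]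
  set G : ℝ := Real.log (g x) with hG
  have hG0 : 0 < G := hw.trans_le hgx
  have hfx0 : 0 < f x := hf_pos x hx0
  have hgx0 : 0 < g x := hg_pos x hx0
  rw [hlogx, Real.norm_of_nonneg hfx0.le, Real.norm_of_nonneg (by positivity), ← mul_div_assoc,
    le_div_iff₀ hG0] at hfgx
  have hg1 : 1 ≤ g x := by
    by_contra h
    have := Real.log_nonpos hgx0.le (not_le.1 h).le
    linarith
  set q : ℕ := ⌈4 * g x⌉₊ with hq
  set L : ℕ := ⌈4 * f x⌉₊ with hL
  have hq1 : 4 * g x ≤ q := Nat.le_ceil _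
  have hq2 : (q : ℝ) < 4 * g x + 1 := Nat.ceil_lt_add_one (by positivity)
  have hL1 : 4 * f x ≤ L := Nat.le_ceil _
  have hL2 : (L : ℝ) < 4 * f x + 1 := Nat.ceil_lt_add_one (by positivity)
  have hL0 : 0 < L := Nat.ceil_pos.2 (by positivity)
  clear_value q L C₁ C₂
  have hq4 : 2 ≤ q := by
    have : (2 : ℝ) ≤ q := by linarith
    exact_mod_cast this
  have hyG : y * G ≤ 4 * ε * ℓ := by nlinarith
  have hC₁G : C₁ * G ≤ ℓ / 2 := by
    have : y * (C₁ * G) ≤ y * (ℓ / 2) := by nlinarith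
    exact le_of_mul_le_mul_left this hy
  have hfℓ : f x ≤ ℓ := by
    have : w * f x ≤ w * ℓ := by nlinarith
    exact le_of_mul_le_mul_left this hw
  have hℓz : ℓ ≤ z := (Real.log_le_sub_one_of_pos (by linarith)).trans (by linarith)
  have hlogq : Real.log q ≤ C₁ * G := by
    have h1 : Real.log q ≤ Real.log (5 * g x) :=
      Real.log_le_log (by linarith) (by linarith)
    rw [Real.log_mul (by norm_num) hgx0.ne'] at h1
    have h2 : Real.log 5 ≤ 2 := by
      rw [Real.log_le_iff_le_exp (by norm_num)]
      have h3 : Real.exp 2 = Real.exp 1 * Real.exp 1 := by rw [← Real.exp_add]; norm_num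
      have := Real.exp_one_gt_d9
      nlinarith
    have h4 : 2 / w * G ≥ 2 := by
      rw [ge_iff_le, div_mul_eq_mul_div, le_div_iff₀ hw]
      linarith
    rw [hC₁, add_mul, one_mul]
    linarith
  have hlogq0 : 0 < Real.log q := Real.log_pos (by linarith)
  refine ⟨z, q, L, hzs, hz12, hq4, hq1, ?_, hL0, ?_, hL1, ?_⟩
  · have : G ≤ ℓ := by nlinarith
    exact (Real.log_le_log_iff hgx0 (by linarith)).1 this
  · have : (L : ℝ) ≤ 5 * z := by linarith
    exact_mod_cast this
  -- Rounding down the logarithm loses at most `log q ≤ ℓ / 2`.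
  · have hk : ℓ / 2 ≤ Nat.log q z * Real.log q := by
      have h1 := Nat.lt_pow_succ_log_self (show 1 < q by omega) z
      have h2 : (z : ℝ) ≤ (q : ℝ) ^ (Nat.log q z + 1) := by exact_mod_cast h1.le
      have h3 := Real.log_le_log (by linarith) h2
      rw [Real.log_pow] at h3
      push_cast at h3
      linarith
    have hLC : (L : ℝ) ≤ C₂ * f x := by
      have : 1 ≤ 1 / y * f x := by
        rw [div_mul_eq_mul_div, one_mul, le_div_iff₀ hy]
        linarith
      rw [hC₂, add_mul]
      linarith
    have h4 : 80 * (L : ℝ) * Real.log q ≤ Nat.log q z * Real.log q := by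
      calc 80 * (L : ℝ) * Real.log q ≤ 80 * (C₂ * f x) * (C₁ * G) := by gcongr
        _ = 80 * (C₂ * C₁) * (f x * G) := by ring
        _ ≤ 80 * (C₂ * C₁) * (ε * (4 * ℓ)) := by gcongr
        _ = ε * (640 * C₁ * C₂) * (ℓ / 2) := by ring
        _ ≤ 1 * (ℓ / 2) := by gcongr
        _ ≤ _ := by linarith
    have h5 := le_of_mul_le_mul_right h4 hlogq0
    exact_mod_cast h5

lemma quietEvent_anti (a : ℕ → unitInterval) (inj : ℕ → ℕ) (jm : ℕ → Bool) {T T' : ℕ}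
    (h : T ≤ T') : quietEvent a inj jm T' ⊆ quietEvent a inj jm T :=
  fun _ hω s hs => hω s (Finset.Icc_subset_Icc_right h hs)

end

theorem theorem3 (A : Algorithm) (a : ℕ → unitInterval) (hA : A.NonAdaptiveBeforeSuccess a)
    (f g : ℝ → ℝ) (hf_pos : ∀ x : ℝ, 0 < x → 0 < f x) (hg_pos : ∀ x : ℝ, 0 < x → 0 < g x)
    (hf : SubLogarithmic f) (hg : SubLogarithmic fun x => Real.log (g x))
    (hfg : f =o[atTop] fun x => Real.log x / Real.log (g x)) :
    ¬ A.AchievesThroughput f g := by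
  intro hthr
  obtain ⟨s₀, hs₀⟩ := mul_log_le_sum_Ioc hA hthr hf_pos hf.isBigO_log
  obtain ⟨z, q, L, hz, hz12, hq, hgq, hgz, hL, hLz, hfL, hLk⟩ :=
    exists_large_scale hf_pos hg_pos hf hg hfg s₀
  have hz12' : (12 : ℝ) ≤ z := by exact_mod_cast hz12
  have hgmono : ∀ s : ℕ, 1 ≤ s → s ≤ z ^ 4 → g s ≤ g ((z : ℝ) ^ 4) := by
    intro s hs1 hs
    have h1 : (0 : ℝ) < s := by exact_mod_cast hs1
    have h2 : (0 : ℝ) < (z : ℝ) ^ 4 := by positivity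
    exact (Real.log_le_log_iff (hg_pos _ h1) (hg_pos _ h2)).1
      (hg.monotoneOn h1 h2 (by exact_mod_cast hs))
  -- the sum of the broadcasting probabilities up to age `z ^ 2`
  have hB : 10 * Real.log z * L ≤ ∑ i ∈ Finset.Ioc 0 (z ^ 2), (a i : ℝ) := by
    have hpow : z * q ^ Nat.log q z ≤ z ^ 2 := by
      rw [sq]; exact Nat.mul_le_mul_left _ (Nat.pow_log_le_self q (by omega))
    have h1 := hs₀ z q (Nat.log q z) hz (by omega) hq fun s hs1 hs => by
      have : g s ≤ g ((z : ℝ) ^ 4) := hgmono s hs1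
        (hs.trans (hpow.trans (Nat.pow_le_pow_right (by omega) (by norm_num))))
      linarith
    have h2 : ∑ i ∈ Finset.Ioc 0 (z * q ^ Nat.log q z), (a i : ℝ) ≤
        ∑ i ∈ Finset.Ioc 0 (z ^ 2), (a i : ℝ) :=
      Finset.sum_le_sum_of_subset_of_nonneg (Finset.Ioc_subset_Ioc_right hpow)
        fun i _ _ => (a i).2.1
    have h3 : (80 : ℝ) * L ≤ Nat.log q z := by exact_mod_cast hLk
    have h4 : 0 ≤ Real.log z := Real.log_natCast_nonneg z
    nlinarith
  set m : ℕ := z ^ 4 / L with hm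
  obtain ⟨o, ho⟩ := exists_blockSlot_quiet a (m := m) hL hB
  have hmL : m * L ≤ z ^ 4 := Nat.div_mul_le_self _ _
  have hmL' : z ^ 4 < m * L + L := Nat.lt_div_mul_add hL
  have hz2 : 12 * z ≤ z ^ 2 := by nlinarith
  have hz3 : 12 * z ^ 2 ≤ z ^ 3 := by
    rw [pow_succ z 2, mul_comm]; exact Nat.mul_le_mul_left _ hz12
  have hz4 : 12 * z ^ 3 ≤ z ^ 4 := by
    rw [pow_succ z 3, mul_comm]; exact Nat.mul_le_mul_left _ hz12
  have hm3 : 3 ≤ m := by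
    by_contra h
    have : m * L ≤ 2 * L := Nat.mul_le_mul_right _ (by omega)
    omega
  obtain ⟨t, ht⟩ : ∃ t, m * L = t + 1 :=
    ⟨m * L - 1, by have := Nat.mul_pos (show 0 < m by omega) hL; omega⟩
  set b₀ : Fin m := ⟨0, by omega⟩
  have hv : blockSlot o b₀ ≤ L := by
    have := (o b₀).2
    simp only [blockSlot, b₀, zero_mul, zero_add]
    omega
  have hjsum : (∑ s ∈ Finset.Icc 1 (t + 1), if decide (s ≤ z ^ 2) = true then 1 else 0 : ℕ)
      = z ^ 2 := by
    rw [← Finset.card_filter]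
    have : (Finset.Icc 1 (t + 1)).filter (fun s => decide (s ≤ z ^ 2) = true) =
        Finset.Icc 1 (z ^ 2) := by
      ext s
      simp only [Finset.mem_filter, Finset.mem_Icc, decide_eq_true_eq]
      omega
    rw [this]
    simp
  have hquiet : coinMeasure (quietEvent a (injectAt (blockSlot o))
      (fun s => decide (s ≤ z ^ 2)) (m * L)) ≤ ENNReal.ofReal (1 / m) := by
    rw [ht]
    refine (measure_mono (quietEvent_anti _ _ _ (Nat.le_succ t))).trans
      (measure_quietEvent_le hA hthr (injectAt (blockSlot o)) (fun s => decide (s ≤ z ^ 2)) t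
        (blockSlot o b₀) m (by unfold blockSlot; omega) ?_ (by omega)
        (ht ▸ sum_injectAt_blockSlot o) ?_)
    · simp [injectAt]
    · rw [hjsum]
      have hgt := hgmono (t + 1) (by omega) (by omega)
      have ht0 : (0 : ℝ) < (t + 1 : ℕ) := by positivity
      have hft : f (t + 1 : ℕ) ≤ f ((z : ℝ) ^ 4) :=
        hf.monotoneOn ht0 (show (0 : ℝ) < (z : ℝ) ^ 4 by positivity)
          (by exact_mod_cast ht ▸ hmL)
      -- Nodes pay for a quarter of the `m * L` slots and jams for at most `z ^ 2 * z`. The system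
      -- is empty only before the first arrival, which comes by slot `L`.
      have h1 : (m : ℝ) * f (t + 1 : ℕ) ≤ (t + 1 : ℕ) / 4 := by
        have h2 : (m : ℝ) * L = (t + 1 : ℕ) := by exact_mod_cast ht
        have h3 : (m : ℝ) * f (t + 1 : ℕ) ≤ m * (L / 4) := by gcongr; linarith
        linarith
      have h2 : ((z ^ 2 : ℕ) : ℝ) * g (t + 1 : ℕ) ≤ (z ^ 3 : ℕ) := by
        push_cast at hgt ⊢
        rw [pow_succ (z : ℝ) 2]
        gcongr
        linarith
      have h3 : 4 * z ^ 3 + 4 * L ≤ 3 * (t + 1) := by omega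
      have h3' : 4 * ((z ^ 3 : ℕ) : ℝ) + 4 * L ≤ 3 * (t + 1 : ℕ) := by exact_mod_cast h3
      have h4 : (blockSlot o b₀ : ℝ) ≤ L := by exact_mod_cast hv
      linarith
  -- The per-slot bound is of order `z ^ (-5)`, which beats a union over at most `z ^ 4` slots.
  have hsmall : ((m * L : ℕ) : ℝ) * (2 * Real.exp 1 * Real.exp (-(10 * Real.log z) / 2)) ≤
      1 / 2 := by
    have h1 : Real.exp (-(10 * Real.log z) / 2) = ((z : ℝ) ^ 5)⁻¹ := by
      rw [show -(10 * Real.log z) / 2 = -((5 : ℕ) * Real.log z) by push_cast; ring, Real.exp_neg,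
        Real.exp_nat_mul, Real.exp_log (by linarith)]
    have h2 : ((m * L : ℕ) : ℝ) ≤ (z : ℝ) ^ 4 := by exact_mod_cast hmL
    have h3 : Real.exp 1 ≤ 3 := by have := Real.exp_one_lt_d9; linarith
    rw [h1]
    calc ((m * L : ℕ) : ℝ) * (2 * Real.exp 1 * ((z : ℝ) ^ 5)⁻¹)
        ≤ (z : ℝ) ^ 4 * (2 * 3 * ((z : ℝ) ^ 5)⁻¹) := by gcongr
      _ = 6 / z := by field_simp; norm_num
      _ ≤ 1 / 2 := by rw [div_le_div_iff₀ (by linarith) (by norm_num)]; linarith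
  have hm3' : (3 : ℝ) ≤ m := by exact_mod_cast hm3
  -- Throughput makes quietness improbable, at most `1 / m ≤ 1 / 3`, while collisions leave its
  -- complement at most `1 / 2`.
  have hone : (1 : ENNReal) ≤ ENNReal.ofReal (1 / 3) + ENNReal.ofReal (1 / 2) := by
    calc (1 : ENNReal) = coinMeasure univ := measure_univ.symm
      _ = coinMeasure (quietEvent a (injectAt (blockSlot o)) (fun s => decide (s ≤ z ^ 2)) (m * L)
          ∪ (quietEvent a (injectAt (blockSlot o)) (fun s => decide (s ≤ z ^ 2)) (m * L))ᶜ) := by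
        rw [union_compl_self]
      _ ≤ _ := measure_union_le _ _
      _ ≤ _ := add_le_add
        (hquiet.trans (ENNReal.ofReal_le_ofReal (one_div_le_one_div_of_le (by norm_num) hm3')))
        (ho.trans (ENNReal.ofReal_le_ofReal hsmall))
  rw [← ENNReal.ofReal_add (by norm_num) (by norm_num), ENNReal.one_le_ofReal] at hone
  norm_num at hone
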